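/- Let $E$ be a global field, that is, a number field or a finite extension of $\mathbb{F}_p(t)$ for some prime $p$. Let $d$ be a natural number, let $H$ be a subgroup of $\mathrm{GL}(d,E)$, and for $k\ge 1$ let $P_k\colon H\to H$ denote the power map $P_k(x)=x^k$. Assume that $P_k$ is surjective on $H$ for some integer $k>1$. Call a subgroup of $\mathrm{GL}(d,E)$ unipotent if $g-1$ is a nilpotent matrix for each of its elements $g$. Then: 1. If $E$ has characteristic $0$, then $H$ contains a unipotent normal subgroup of finite index in $H$. 2. If $E$ has characteristic $p>0$, then $H$ is locally finite, that is, every finitely generated subgroup of $H$ is finite. 3. If $E$ has characteristic $p>0$ and $p$ divides $k$, then $H$ is finite. 4. If $P_n$ is surjective on $H$ for every integer $n\ge 1$, then $H$ is unipotent if $E$ has characteristic $0$, and $H$ is trivial if $E$ has positive characteristic. -/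

import Mathlib

/-- A global field: a number field, or a finite extension of the rational function field
`𝔽_p(t)` for some prime `p`. -/
def IsGlobalField (E : Type*) [Field E] : Prop :=
  NumberField E ∨
    ∃ (p : ℕ) (_ : Fact p.Prime) (_ : Algebra (RatFunc (ZMod p)) E),
      FunctionField (ZMod p) E

/-- The power map `P_k : x ↦ x ^ k` is surjective on the group `G`. -/
def PowerMapSurjective (G : Type*) [Group G] (k : ℕ) : Prop :=
  Function.Surjective fun x : G => x ^ k

/-- A group of matrices is unipotent if `g - 1` is nilpotent for each of its elements `g`. -/
def IsUnipotentGroup {E : Type*} [Field E] {d : ℕ}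
    (U : Subgroup (Matrix.GeneralLinearGroup (Fin d) E)) : Prop :=
  ∀ g ∈ U, IsNilpotent ((g : Matrix (Fin d) (Fin d) E) - 1)

/-- A group is locally finite if each of its finitely generated subgroups is finite. -/
def IsLocallyFiniteGroup (G : Type*) [Group G] : Prop :=
  ∀ N : Subgroup G, N.FG → Finite N

/-!
Why surjectivity of a power map is so restrictive over a global field `E`: an eigenvalue `x` of an
element of `H` has, for every `n`, a `k ^ n`-th root of degree at most `d` over `E`, namely an
eigenvalue of a `k ^ n`-th root in `H`. Such an `x` is a root of unity, of order bounded in terms of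
`d` and `E` (`IsGlobalField.exists_pow_eq_one`). Over a number field, norms turn the roots into
elements of `E(x)`, and Northcott's theorem leaves only finitely many of them. Over a finite
extension of `F(t)`, with `F` finite, an element `y` transcendental over `F` has degree `k ^ n` over
`F(y ^ k ^ n)`, which is too large for bounded degrees; so `x` is algebraic over `F`, and its degree
over `F` is at most its degree over `F(t)`.

Hence `g ^ N - 1` is nilpotent for a fixed `N` and all `g` in `H`. Let `A` be the algebra spanned by
`H` over the algebraic closure `K` and `J` its radical, which is nilpotent. By Wedderburn's theorem
`A / J` is a product of matrix algebras. Each of them is spanned by the image of `H`, whose elements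
have finitely many traces; as the trace form is nondegenerate, the image of `H` in `A / J` is
finite. So `U = H ∩ (1 + J)` is a normal subgroup of finite index, and products of sufficiently many
elements `u - 1` with `u` in `U` vanish (`exists_normal_finiteIndex_nilpotent`).

In characteristic `0` this is the claim. In characteristic `p`, a finitely generated subgroup of `U`
lies in the span over the prime field of finitely many products, so it is finite, and `H` is locally
finite. Moreover `H` has finite exponent; if the `p`-th power map is surjective, then `H` has no
`p`-torsion, so the `p`-group `U` is trivial and `H` is finite. Finally, if all power maps are
surjective, every element of `H` is a power with exponent the index of `U` (or the order of `H`, if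
finite), hence it lies in `U` (or is trivial).
-/

open scoped IntermediateField

/-! ### Groups of matrices with eigenvalues of bounded order -/

lemma pow_eq_one_of_mem_roots_charpoly {K n : Type*} [Field K] [Fintype n] [DecidableEq n]
    {M : Matrix n n K} {N : ℕ} (h : IsNilpotent (M ^ N - 1)) {x : K}
    (hx : x ∈ M.charpoly.roots) : x ^ N = 1 := by
  obtain ⟨r, hr⟩ := h
  have h0 : Polynomial.aeval M (((Polynomial.X : Polynomial K) ^ N - 1) ^ r) = 0 := by
    simpa using hr
  have hs := spectrum.subset_polynomial_aeval M (((Polynomial.X : Polynomial K) ^ N - 1) ^ r)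
    ⟨x, Matrix.mem_spectrum_of_isRoot_charpoly (Polynomial.isRoot_of_mem_roots hx), rfl⟩
  rw [h0] at hs
  have : (x ^ N - 1) ^ r = 0 := by
    by_contra hne
    refine hs ?_
    rw [spectrum.mem_resolventSet_iff, sub_zero]
    simpa using (IsUnit.mk0 _ hne).map (algebraMap K (Matrix n n K))
  exact sub_eq_zero.1 (eq_zero_of_pow_eq_zero this)

lemma isNilpotent_pow_sub_one_of_roots_charpoly {K n : Type*} [Field K] [IsAlgClosed K] [Fintype n]
    [DecidableEq n] {M : Matrix n n K} {N : ℕ} (h : ∀ x ∈ M.charpoly.roots, x ^ N = 1) :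
    IsNilpotent (M ^ N - 1) := by
  have hdvd : M.charpoly ∣ ((Polynomial.X : Polynomial K) ^ N - 1) ^ M.charpoly.roots.card := by
    conv_lhs => rw [(IsAlgClosed.splits M.charpoly).eq_prod_roots_of_monic M.charpoly_monic]
    rw [← Multiset.prod_replicate, ← Multiset.map_const']
    refine Multiset.prod_dvd_prod_of_dvd _ _ fun x hx ↦ ?_
    rw [Polynomial.dvd_iff_isRoot]
    simp [h x hx]
  obtain ⟨q, hq⟩ := hdvd
  refine ⟨M.charpoly.roots.card, ?_⟩
  have := congrArg (Polynomial.aeval M) hq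
  simpa [Matrix.aeval_self_charpoly] using this

lemma finite_trace_of_isNilpotent_pow_sub_one (K n : Type*) [Field K] [IsAlgClosed K] [Fintype n]
    [DecidableEq n] {N : ℕ} (hN : 0 < N) :
    (Matrix.trace '' {M : Matrix n n K | IsNilpotent (M ^ N - 1)}).Finite := by
  classical
  have hfin : {x : K | x ^ N = 1}.Finite := by
    refine (Polynomial.nthRoots N (1 : K)).toFinset.finite_toSet.subset fun x hx ↦ ?_
    simpa [Polynomial.mem_nthRoots hN] using hx
  have := hfin.to_subtype
  let f : Sym {x : K | x ^ N = 1} (Fintype.card n) → K := fun s ↦ (s.1.map Subtype.val).sum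
  refine (Set.finite_range f).subset ?_
  rintro _ ⟨M, hM, rfl⟩
  have hM' : IsNilpotent (M ^ N - 1) := hM
  have hs := IsAlgClosed.splits M.charpoly
  refine ⟨⟨M.charpoly.roots.attach.map
    fun x ↦ ⟨x.1, pow_eq_one_of_mem_roots_charpoly hM' x.2⟩, ?_⟩, ?_⟩
  · rw [Multiset.card_map, Multiset.card_attach, ← hs.natDegree_eq_card_roots,
      Matrix.charpoly_natDegree_eq_dim]
  · simp [f, Multiset.map_map, Matrix.trace_eq_sum_roots_charpoly]

/-- A spanning multiplicative family of matrices with finitely many traces is finite, by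
nondegeneracy of the trace form. -/
lemma finite_range_of_finite_trace {K n G : Type*} [Field K] [Fintype n]
    [DecidableEq n] [Monoid G] (ρ : G →* Matrix n n K)
    (hspan : Submodule.span K (Set.range ρ) = ⊤)
    (hfin : (Set.range fun g ↦ (ρ g).trace).Finite) : (Set.range ρ).Finite := by
  -- The traces of the products with a finite spanning subset `s` determine a matrix.
  obtain ⟨s, hs, -, hsp, -⟩ := Submodule.exists_finset_span_eq_linearIndepOn K (Set.range ρ)
  have hT := hfin.to_subtype
  choose! c hc using fun x (hx : x ∈ s) ↦ hs hx
  let f : G → (s → Set.range fun g ↦ (ρ g).trace) := fun g x ↦ ⟨(ρ (g * c x)).trace, g * c x, rfl⟩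
  refine Set.Finite.of_finite_image (f := fun M : Matrix n n K ↦ fun x : s ↦ (M * x.1).trace)
    ((Set.finite_range fun (t : s → Set.range fun g ↦ (ρ g).trace) x ↦ (t x : K)).subset ?_) ?_
  · rintro _ ⟨_, ⟨g, rfl⟩, rfl⟩
    exact ⟨f g, by ext x; simp [f, hc x.1 x.2]⟩
  · rintro M - M' - h
    rw [Matrix.ext_iff_trace_mul_right]
    intro y
    have hy : y ∈ Submodule.span K (s : Set (Matrix n n K)) := by rw [hsp, hspan]; trivial
    induction hy using Submodule.span_induction with
    | mem x hx => exact congrFun h ⟨x, hx⟩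
    | zero => simp
    | add x y _ _ hx hy => simp [mul_add, hx, hy]
    | smul a x _ hx => simp [hx]

/-- Modulo its radical, `A` is a product of matrix algebras, in each of which the image of `G` is
finite. The kernel of `G` in this product is `U`, as `ρ u - 1` then lies in the nilpotent radical.
The condition on lists says that the `ρ u - 1` for `u` in `U` generate a nilpotent algebra. -/
theorem exists_normal_finiteIndex_nilpotent_of_span_eq_top {K A G : Type*} [Field K]
    [IsAlgClosed K] [Ring A] [Algebra K A] [FiniteDimensional K A] [Group G] (ρ : G →* A)
    (hspan : Submodule.span K (Set.range ρ) = ⊤) {N : ℕ} (hN : 0 < N)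
    (hρ : ∀ g, IsNilpotent (ρ g ^ N - 1)) :
    ∃ U : Subgroup G, U.Normal ∧ U.FiniteIndex ∧
      ∃ m, ∀ l : List G, (∀ g ∈ l, g ∈ U) → l.length = m → (l.map fun g ↦ ρ g - 1).prod = 0 := by
  have := IsArtinianRing.of_finite K A
  obtain ⟨m, hm⟩ := IsSemiprimaryRing.isNilpotent (R := A)
  obtain ⟨r, d, -, ⟨e⟩⟩ :=
    IsSemisimpleRing.exists_algEquiv_pi_matrix_of_isAlgClosed K (A ⧸ Ring.jacobson A)
  let q : A →ₐ[K] A ⧸ Ring.jacobson A := Ideal.Quotient.mkₐ K _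
  let φ : A →ₐ[K] (∀ i, Matrix (Fin (d i)) (Fin (d i)) K) := e.toAlgHom.comp q
  have hφ : Function.Surjective φ := e.surjective.comp Ideal.Quotient.mk_surjective
  let ψ : G →* (∀ i, Matrix (Fin (d i)) (Fin (d i)) K) := (φ : A →* _).comp ρ
  have hfin (i : Fin r) : (Set.range fun g ↦ ψ g i).Finite := by
    let p : A →ₐ[K] Matrix (Fin (d i)) (Fin (d i)) K := (Pi.evalAlgHom K _ i).comp φ
    have hp : Function.Surjective p := (Function.surjective_eval i).comp hφ
    refine finite_range_of_finite_trace ((p : A →* Matrix (Fin (d i)) (Fin (d i)) K).comp ρ) ?_ ?_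
    · have := congrArg (Submodule.map p.toLinearMap) hspan
      rw [Submodule.map_span, Submodule.map_top, LinearMap.range_eq_top.2 hp,
        ← Set.range_comp] at this
      exact this
    · refine (finite_trace_of_isNilpotent_pow_sub_one K (Fin (d i)) hN).subset ?_
      rintro _ ⟨g, rfl⟩
      refine ⟨p (ρ g), ?_, rfl⟩
      simpa using (hρ g).map p
  have hψ : (Set.range ψ).Finite := by
    refine (Set.Finite.pi' hfin).subset ?_
    rintro _ ⟨g, rfl⟩ i
    exact ⟨g, rfl⟩
  have : Finite ψ.toHomUnits.range := by
    have : (Set.range ψ.toHomUnits).Finite := by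
      refine Set.Finite.of_finite_image (f := Units.val) (hψ.subset ?_) Units.val_injective.injOn
      rintro _ ⟨_, ⟨g, rfl⟩, rfl⟩
      exact ⟨g, rfl⟩
    exact this.to_subtype
  refine ⟨ψ.toHomUnits.ker, inferInstance, inferInstance, m, ?_⟩
  have hmem (g : G) (hg : g ∈ ψ.toHomUnits.ker) : ρ g - 1 ∈ Ring.jacobson A := by
    have h1 : ψ g = 1 := congrArg Units.val hg
    have h2 : φ (ρ g - 1) = 0 := by
      rw [map_sub, map_one, sub_eq_zero]; exact h1
    have h3 : q (ρ g - 1) = 0 := e.injective (h2.trans (map_zero e).symm)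
    exact Ideal.Quotient.eq_zero_iff_mem.1 h3
  rintro l hl rfl
  have hlist (l : List G) (hl : ∀ g ∈ l, g ∈ ψ.toHomUnits.ker) :
      (l.map fun g ↦ ρ g - 1).prod ∈ Ring.jacobson A ^ l.length := by
    induction l with
    | nil => simp [Submodule.pow_zero, Ideal.one_eq_top]
    | cons a l ih =>
      rw [List.map_cons, List.prod_cons, List.length_cons, Ideal.IsTwoSided.pow_succ]
      exact Ideal.mul_mem_mul (hmem a (hl a (by simp))) (ih fun g hg ↦ hl g (by simp [hg]))
  simpa [hm] using hlist l hl

/-- The span of the image of a group is a subalgebra, so the assumption that the image spans the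
algebra is no restriction. -/
theorem exists_normal_finiteIndex_nilpotent {K A G : Type*} [Field K]
    [IsAlgClosed K] [Ring A] [Algebra K A] [FiniteDimensional K A] [Group G] (ρ : G →* A)
    {N : ℕ} (hN : 0 < N) (hρ : ∀ g, IsNilpotent (ρ g ^ N - 1)) :
    ∃ U : Subgroup G, U.Normal ∧ U.FiniteIndex ∧
      ∃ m, ∀ l : List G, (∀ g ∈ l, g ∈ U) → l.length = m → (l.map fun g ↦ ρ g - 1).prod = 0 := by
  let B : Subalgebra K A := Algebra.adjoin K (Set.range ρ)
  let σ : G →* B := ρ.codRestrict B fun g ↦ Algebra.subset_adjoin ⟨g, rfl⟩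
  have hspan : Submodule.span K (Set.range σ) = ⊤ := by
    have hinj : Function.Injective (Submodule.map B.val.toLinearMap) :=
      Submodule.map_injective_of_injective Subtype.val_injective
    apply hinj
    rw [Submodule.map_span, Submodule.map_top, ← Set.range_comp]
    have h1 : B.val.toLinearMap.range = Subalgebra.toSubmodule B := by
      ext x; simp
    have h2 : (B.val.toLinearMap ∘ σ : G → A) = ρ := rfl
    rw [h1, h2, Algebra.adjoin_eq_span, ← MonoidHom.coe_mrange, Submonoid.closure_eq]
  obtain ⟨U, hU, hU', m, h⟩ := exists_normal_finiteIndex_nilpotent_of_span_eq_top σ hspan hN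
    fun g ↦ by
      obtain ⟨r, hr⟩ := hρ g
      exact ⟨r, Subtype.ext (by simpa [σ] using hr)⟩
  refine ⟨U, hU, hU', m, fun l hl hlm ↦ ?_⟩
  have := congrArg B.val (h l hl hlm)
  rw [map_list_prod, List.map_map] at this
  exact this

/-! ### Finitely generated unipotent groups in positive characteristic -/

/-- Over the prime field, the algebra generated by the `ρ s - 1` for `s` in a finite symmetric
generating set is spanned by the finitely many products of bounded length, so it is finite. -/
theorem finite_of_fg_of_forall_list_prod_eq_zero {G R : Type*} [Group G] [Group.FG G] [Ring R]
    {p : ℕ} [NeZero p] [Algebra (ZMod p) R] (ρ : G →* R) (hρ : Function.Injective ρ) {m : ℕ}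
    (h : ∀ l : List G, l.length = m → (l.map fun g ↦ ρ g - 1).prod = 0) : Finite G := by
  obtain ⟨S, hS⟩ := Group.fg_def.1 ‹Group.FG G›
  -- `T` is closed under inversion, and `W` is spanned by the products of length less than `m`.
  let T : Set G := S ∪ (S : Set G)⁻¹
  have hT : T.Finite := S.finite_toSet.union S.finite_toSet.inv
  let L : Set (List G) := {l | (∀ g ∈ l, g ∈ T) ∧ l.length < m}
  have hL : L.Finite := by
    have := hT.to_subtype
    refine ((List.finite_length_lt T m).image (List.map Subtype.val)).subset ?_
    rintro l ⟨hl, hlm⟩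
    exact ⟨l.attach.map fun g ↦ ⟨g.1, hl g.1 g.2⟩, by simpa using hlm, by simp⟩
  let W : Submodule (ZMod p) R :=
    Submodule.span (ZMod p) ((fun l : List G ↦ (l.map fun g ↦ ρ g - 1).prod) '' L)
  have hW : Finite W := by
    have : Module.Finite (ZMod p) W := Module.Finite.span_of_finite _ (hL.image _)
    exact Module.finite_of_finite (ZMod p)
  -- Multiplying by one more factor either gives a generator again or reaches length `m`.
  have hmul (t : G) (ht : t ∈ T) (x : R) (hx : x ∈ W) : x * (ρ t - 1) ∈ W := by
    induction hx using Submodule.span_induction with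
    | mem x hx =>
      obtain ⟨l, ⟨hl, hlm⟩, rfl⟩ := hx
      have heq : (l.map fun g ↦ ρ g - 1).prod * (ρ t - 1) =
        ((l ++ [t]).map fun g ↦ ρ g - 1).prod := by simp
      simp only [heq]
      by_cases hlen : (l ++ [t]).length = m
      · rw [h _ hlen]; exact W.zero_mem
      · refine Submodule.subset_span ⟨l ++ [t], ⟨?_, ?_⟩, rfl⟩
        · intro g hg
          rcases List.mem_append.1 hg with hg | hg
          · exact hl g hg
          · rw [List.mem_singleton.1 hg]; exact ht
        · simp only [List.length_append, List.length_singleton] at hlen ⊢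
          omega
    | zero => simp
    | add x y _ _ hx hy => rw [add_mul]; exact W.add_mem hx hy
    | smul a x _ hx => rw [smul_mul_assoc]; exact W.smul_mem a hx
  have hmem (t : G) (ht : t ∈ T) (x : R) (hx : x ∈ W) : x * ρ t ∈ W := by
    have := W.add_mem (hmul t ht x hx) hx
    rwa [mul_sub, mul_one, sub_add_cancel] at this
  have hone : (1 : R) ∈ W := by
    rcases Nat.eq_zero_or_pos m with rfl | hm
    · have h1 : (1 : R) = 0 := by simpa using h [] rfl
      rw [h1]; exact W.zero_mem
    · exact Submodule.subset_span ⟨[], ⟨by simp, hm⟩, by simp⟩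
  have hall (g : G) : ρ g ∈ W := by
    have hg : g ∈ Subgroup.closure (S : Set G) := by rw [hS]; trivial
    induction hg using Subgroup.closure_induction_right with
    | one => simpa using hone
    | mul_right x _ y hy ih =>
      rw [map_mul]; exact hmem _ (Or.inl hy) _ ih
    | mul_inv_cancel x _ y hy ih =>
      rw [map_mul]; exact hmem _ (Or.inr (by simpa using hy)) _ ih
  exact Finite.of_injective (fun g ↦ (⟨ρ g, hall g⟩ : W)) fun a b hab ↦
    hρ (congrArg Subtype.val hab)

/-! ### Infinitely divisible elements of bounded degree: number fields -/

/-- The order `m` of a root of unity is bounded in terms of `φ m`, hence in terms of its degree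
over `ℚ`. -/
lemma Nat.dvd_factorial_pow_of_totient_le {m D : ℕ} (hm : 0 < m) (h : m.totient ≤ D) :
    m ∣ ((D + 1).factorial) ^ (D + 1) := by
  rw [Nat.dvd_iff_prime_pow_dvd_dvd]
  intro p a hp hpa
  rcases Nat.eq_zero_or_pos a with rfl | ha
  · simp
  have h1 : p ^ (a - 1) * (p - 1) ≤ D := by
    rw [← Nat.totient_prime_pow hp ha]
    exact (Nat.le_of_dvd (Nat.totient_pos.2 hm) (Nat.totient_dvd_of_dvd hpa)).trans h
  have hp1 : 0 < p - 1 := Nat.sub_pos_of_lt hp.one_lt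
  have h2 : p - 1 ≤ D := (Nat.le_mul_of_pos_left _ (pow_pos hp.pos _)).trans h1
  have h3 : p ^ (a - 1) ≤ D := (Nat.le_mul_of_pos_right _ hp1).trans h1
  have h4 : a - 1 < p ^ (a - 1) := Nat.lt_pow_self hp.one_lt
  exact (pow_dvd_pow_of_dvd (Nat.dvd_factorial hp.pos (by omega)) a).trans
    (pow_dvd_pow _ (by omega))

lemma minpoly.natDegree_le_natDegree_mul_finrank {F E K : Type*} [Field F] [Field E] [Field K]
    [Algebra F E] [Algebra E K] [Algebra F K] [IsScalarTower F E K] [FiniteDimensional F E] {x : K}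
    (hx : IsIntegral E x) :
    (minpoly F x).natDegree ≤ (minpoly E x).natDegree * Module.finrank F E := by
  have : FiniteDimensional E E⟮x⟯ := IntermediateField.adjoin.finiteDimensional hx
  have : FiniteDimensional F E⟮x⟯ := FiniteDimensional.trans F E _
  have : IsScalarTower F E⟮x⟯ K :=
    IsScalarTower.of_algebraMap_eq fun r ↦ by
      rw [IsScalarTower.algebraMap_apply F E K, IsScalarTower.algebraMap_apply F E E⟮x⟯]
      rfl
  let g : E⟮x⟯ := IntermediateField.AdjoinSimple.gen E x
  have h1 : minpoly F x = minpoly F g :=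
    minpoly.algebraMap_eq (A := F) (algebraMap E⟮x⟯ K).injective g
  rw [h1]
  refine (minpoly.natDegree_le g).trans ?_
  rw [← Module.finrank_mul_finrank F E E⟮x⟯, mul_comm, IntermediateField.adjoin.finrank hx]

/-- The roots `ν` have height at most that of `u`, so two of them agree by Northcott's theorem. -/
lemma NumberField.exists_pow_eq_one_of_forall_exists_pow_eq {L : Type*} [Field L] [NumberField L]
    {k : ℕ} (hk : 1 < k) {u : L} (hu : u ≠ 0) (h : ∀ n : ℕ, ∃ ν : L, ν ^ k ^ n = u) :
    ∃ m : ℕ, 0 < m ∧ u ^ m = 1 := by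
  choose ν hν using h
  have hmem (n : ℕ) : ν n ∈ {x : L | Height.mulHeight₁ x ≤ Height.mulHeight₁ u} := by
    change Height.mulHeight₁ (ν n) ≤ Height.mulHeight₁ u
    rw [← hν n, Height.mulHeight₁_pow]
    exact le_self_pow₀ (Height.one_le_mulHeight₁ _) (pow_pos (by omega) n).ne'
  have hfin := Northcott.finite_le (h := Height.mulHeight₁ (K := L)) (Height.mulHeight₁ u)
  obtain ⟨a, -, b, -, hab, heq⟩ :=
    Set.infinite_univ.exists_ne_map_eq_of_mapsTo (f := ν) (fun n _ ↦ hmem n) hfin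
  wlog hlt : a < b generalizing a b
  · exact this b a hab.symm heq.symm (by omega)
  have hlt' : k ^ a < k ^ b := Nat.pow_lt_pow_right hk hlt
  have hν0 : ν b ≠ 0 := by
    intro h0
    have := hν b
    rw [h0, zero_pow (pow_pos (by omega) b).ne'] at this
    exact hu this.symm
  have h1 : ν b ^ (k ^ b - k ^ a) = 1 := by
    have h2 : ν b ^ k ^ a * ν b ^ (k ^ b - k ^ a) = ν b ^ k ^ a := by
      rw [← pow_add, Nat.add_sub_cancel' hlt'.le, hν b, ← heq, hν a]
    exact mul_left_cancel₀ (pow_ne_zero _ hν0) (by rw [h2, mul_one])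
  refine ⟨k ^ b - k ^ a, by omega, ?_⟩
  rw [← hν b, ← pow_mul, mul_comm, pow_mul, h1, one_pow]

/-- If `x` has an `n`-th root of degree at most `d` over `L`, then a power of `x` depending only on
`d` has an `n`-th root in `L` itself, obtained from the norm. -/
lemma exists_pow_eq_pow_factorial {L K : Type*} [Field L] [Field K] [Algebra L K] {x : L} {y : K}
    {n d : ℕ} (hy : IsIntegral L y) (hd : (minpoly L y).natDegree ≤ d)
    (hyx : y ^ n = algebraMap L K x) : ∃ ν : L, ν ^ n = x ^ d.factorial := by
  have : FiniteDimensional L L⟮y⟯ := IntermediateField.adjoin.finiteDimensional hy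
  let z : L⟮y⟯ := IntermediateField.AdjoinSimple.gen L y
  have hz : z ^ n = algebraMap L L⟮y⟯ x := Subtype.ext hyx
  have hpos : 0 < Module.finrank L L⟮y⟯ := Module.finrank_pos
  rw [← IntermediateField.adjoin.finrank hy] at hd
  obtain ⟨c, hc⟩ := Nat.dvd_factorial hpos hd
  refine ⟨Algebra.norm L z ^ c, ?_⟩
  rw [← pow_mul, mul_comm, pow_mul, ← map_pow, hz, Algebra.norm_algebraMap, ← pow_mul, ← hc]

/-- Taking norms down to `E(x)` makes a power of `x` infinitely divisible by `k` in `E(x)`, so `x`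
is a root of unity; its order is bounded because its degree is. -/
theorem NumberField.pow_eq_one_of_forall_exists_root {E K : Type*} [Field E] [NumberField E]
    [Field K] [Algebra E K] {k d : ℕ} (hk : 1 < k) {x : K} (hx : x ≠ 0)
    (h : ∀ n : ℕ, ∃ y : K, y ^ k ^ n = x ∧ IsIntegral E y ∧ (minpoly E y).natDegree ≤ d) :
    x ^ ((d * Module.finrank ℚ E + 1).factorial) ^ (d * Module.finrank ℚ E + 1) = 1 := by
  have : CharZero K := charZero_of_injective_algebraMap (algebraMap E K).injective
  obtain ⟨hxint, hxdeg⟩ : IsIntegral E x ∧ (minpoly E x).natDegree ≤ d := by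
    obtain ⟨y, rfl, hy⟩ := h 0
    simpa using hy
  let L := E⟮x⟯
  have : FiniteDimensional E L := IntermediateField.adjoin.finiteDimensional hxint
  have : FiniteDimensional ℚ L := FiniteDimensional.trans ℚ E L
  have : NumberField L := { to_charZero := inferInstance, to_finiteDimensional := inferInstance }
  let g : L := IntermediateField.AdjoinSimple.gen E x
  have hg : (g : K) = x := rfl
  have hg0 : g ≠ 0 := fun h0 ↦ hx (by rw [← hg, h0]; rfl)
  have key (n : ℕ) : ∃ ν : L, ν ^ k ^ n = g ^ d.factorial := by
    obtain ⟨y, hyx, hy, hyd⟩ := h n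
    have hyL : IsIntegral L y := hy.tower_top
    refine exists_pow_eq_pow_factorial hyL ?_ (x := g) (n := k ^ n) hyx
    refine le_trans ?_ hyd
    refine (Polynomial.natDegree_le_of_dvd (minpoly.dvd_map_of_isScalarTower E L y)
      (Polynomial.map_ne_zero (minpoly.ne_zero hy))).trans ?_
    exact Polynomial.natDegree_map_le
  obtain ⟨m, hm, hum⟩ :=
    NumberField.exists_pow_eq_one_of_forall_exists_pow_eq hk (pow_ne_zero _ hg0) key
  have hxm : x ^ (d.factorial * m) = 1 := by
    rw [pow_mul]
    exact congrArg (Subtype.val : L → K) hum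
  have ho : 0 < orderOf x :=
    orderOf_pos_iff.2 (isOfFinOrder_iff_pow_eq_one.2 ⟨_, by positivity, hxm⟩)
  refine orderOf_dvd_iff_pow_eq_one.1 (Nat.dvd_factorial_pow_of_totient_le ho ?_)
  rw [← Polynomial.natDegree_cyclotomic (orderOf x) ℚ,
    Polynomial.cyclotomic_eq_minpoly_rat (IsPrimitiveRoot.orderOf x) ho]
  exact (minpoly.natDegree_le_natDegree_mul_finrank hxint).trans (Nat.mul_le_mul_right _ hxdeg)

/-! ### Infinitely divisible elements of bounded degree: function fields -/

/-- The field `F(y)` is a copy of the rational function field, where the degree over `F(f)` is the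
degree of `f`. -/
lemma IntermediateField.relfinrank_adjoin_pow {F K : Type*} [Field F] [Field K] [Algebra F K]
    {y : K} (hy : Transcendental F y) {m : ℕ} :
    (F⟮y ^ m⟯).relfinrank F⟮y⟯ = m := by
  let f : RatFunc F →ₐ[F] K :=
    F⟮y⟯.val.comp (RatFunc.algEquivOfTranscendental y hy : RatFunc F →ₐ[F] F⟮y⟯)
  have hf : f RatFunc.X = y := by simp [f]
  have h1 : F⟮y ^ m⟯ = F⟮(RatFunc.X : RatFunc F) ^ m⟯.map f := by
    rw [IntermediateField.adjoin_map, Set.image_singleton, map_pow, hf]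
  have h2 : F⟮y⟯ = (⊤ : IntermediateField F (RatFunc F)).map f := by
    rw [← RatFunc.adjoin_X, IntermediateField.adjoin_map, Set.image_singleton, hf]
  rw [h1, h2, IntermediateField.relfinrank_map_map, IntermediateField.relfinrank_top_right,
    RatFunc.finrank_eq_max_natDegree]
  have h3 : (RatFunc.X : RatFunc F) ^ m =
      algebraMap (Polynomial F) (RatFunc F) (Polynomial.X ^ m) := by simp
  rw [h3, RatFunc.num_algebraMap, RatFunc.denom_algebraMap]
  simp

lemma IntermediateField.relfinrank_restrictScalars_adjoin_simple {F K : Type*} [Field F] [Field K]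
    [Algebra F K] (A : IntermediateField F K) {x : K} (hx : IsIntegral A x) :
    A.relfinrank (A⟮x⟯.restrictScalars F) = (minpoly A x).natDegree := by
  have hle : A ≤ A⟮x⟯.restrictScalars F := fun a ha ↦ A⟮x⟯.algebraMap_mem ⟨a, ha⟩
  rw [IntermediateField.relfinrank_eq_finrank_of_le hle,
    ← IntermediateField.adjoin.finrank hx]
  rfl

section

variable {F K : Type*} [Field F] [Field K] [Algebra F K] [Algebra (RatFunc F) K]
  [IsScalarTower F (RatFunc F) K]

/-- If `x` were transcendental, a root `y` with `y ^ k ^ n = x` would have degree `k ^ n` over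
`F(x)`, whereas the degree of `F(t, x, y)` over `F(x)` is at most `D` times that of `F(t, x)`, for
all `n`. -/
theorem RatFunc.isAlgebraic_of_forall_exists_root [Algebra.IsAlgebraic (RatFunc F) K]
    {k D : ℕ} (hk : 1 < k) {x : K}
    (h : ∀ n : ℕ, ∃ y : K, y ^ k ^ n = x ∧ (minpoly (RatFunc F) y).natDegree ≤ D) :
    IsAlgebraic F x := by
  by_contra hx
  have hx : Transcendental F x := hx
  let t : K := algebraMap (RatFunc F) K RatFunc.X
  -- As `K` has transcendence degree one, `x` is a transcendence basis as well as `t`.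
  have ht : IsIntegral F⟮x⟯ t := by
    have hind : AlgebraicIndependent F (fun _ : Unit ↦ x) :=
      (algebraicIndependent_unique_type_iff).2 hx
    have hbX : IsTranscendenceBasis F (fun _ : Unit ↦ t) := by
      have h1 : IsTranscendenceBasis F (fun _ : Unit ↦ (RatFunc.X : RatFunc F)) := by
        have : Algebra.IsAlgebraic (Polynomial F) (RatFunc F) :=
          (IsFractionRing.comap_isAlgebraic_iff (K := RatFunc F)).2 inferInstance
        have := (IsTranscendenceBasis.polynomial Unit F).algebraMap_comp (A := RatFunc F)
        simpa [Function.comp_def] using this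
      exact h1.algebraMap_comp
    have htr : Cardinal.lift.{0} (Algebra.trdeg F K) ≤ Cardinal.lift (Cardinal.mk Unit) :=
      hbX.lift_cardinalMk_eq_trdeg.ge
    have hb := hind.isTranscendenceBasis_of_lift_trdeg_le_of_finite htr
    have := hb.isAlgebraic_field
    rw [Set.range_const] at this
    exact (Algebra.IsAlgebraic.isAlgebraic t).isIntegral
  -- The tower `A = F(x)`, `B = F(x, t)`, `C = F(x, t, y)`.
  let A : IntermediateField F K := F⟮x⟯
  let B : IntermediateField F K := A⟮t⟯.restrictScalars F
  have hAB : A ≤ B := fun a ha ↦ A⟮t⟯.algebraMap_mem ⟨a, ha⟩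
  have htB : t ∈ B := IntermediateField.mem_adjoin_simple_self A t
  let f : RatFunc F →ₐ[F] K := IsScalarTower.toAlgHom F (RatFunc F) K
  have hfB (r : RatFunc F) : f r ∈ B := by
    have h1 : (⊤ : IntermediateField F (RatFunc F)).map f ≤ B := by
      rw [← RatFunc.adjoin_X, IntermediateField.adjoin_map, Set.image_singleton]
      exact IntermediateField.adjoin_simple_le_iff.2 htB
    exact h1 ⟨r, trivial, rfl⟩
  let fB : RatFunc F →+* B := (f : RatFunc F →+* K).codRestrict B hfB
  obtain ⟨n, hn⟩ : ∃ n, (minpoly A t).natDegree * D < k ^ n :=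
    ⟨_, Nat.lt_pow_self hk⟩
  obtain ⟨y, hyx, hyD⟩ := h n
  have hy : IsIntegral (RatFunc F) y := Algebra.IsIntegral.isIntegral y
  have hcomp : (algebraMap B K).comp fB = algebraMap (RatFunc F) K := rfl
  have hmonic := (minpoly.monic hy).map fB
  have haev : Polynomial.aeval y ((minpoly (RatFunc F) y).map fB) = 0 := by
    rw [Polynomial.aeval_def, Polynomial.eval₂_map, hcomp, ← Polynomial.aeval_def, minpoly.aeval]
  have hyB : IsIntegral B y := ⟨_, hmonic, haev⟩
  have hyBD : (minpoly B y).natDegree ≤ D :=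
    ((Polynomial.natDegree_le_natDegree (minpoly.min B y hmonic haev)).trans
      Polynomial.natDegree_map_le).trans hyD
  let C : IntermediateField F K := B⟮y⟯.restrictScalars F
  have hBC : B ≤ C := fun a ha ↦ B⟮y⟯.algebraMap_mem ⟨a, ha⟩
  have hyC : F⟮y⟯ ≤ C :=
    IntermediateField.adjoin_simple_le_iff.2 (IntermediateField.mem_adjoin_simple_self B y)
  have hAy : A ≤ F⟮y⟯ := by
    refine IntermediateField.adjoin_simple_le_iff.2 ?_
    rw [← hyx]
    exact pow_mem (IntermediateField.mem_adjoin_simple_self F y) _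
  have hytr : Transcendental F y := fun hy' ↦ hx (hyx ▸ hy'.pow _)
  have h1 := IntermediateField.relfinrank_mul_relfinrank hAB hBC
  have h2 := IntermediateField.relfinrank_mul_relfinrank hAy hyC
  have h3 : A.relfinrank F⟮y⟯ = k ^ n := by
    simp only [A, ← hyx]
    exact IntermediateField.relfinrank_adjoin_pow hytr
  rw [IntermediateField.relfinrank_restrictScalars_adjoin_simple A ht,
    IntermediateField.relfinrank_restrictScalars_adjoin_simple B hyB] at h1
  have h4 : 0 < (minpoly A t).natDegree * (minpoly B y).natDegree :=
    Nat.mul_pos (minpoly.natDegree_pos ht) (minpoly.natDegree_pos hyB)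
  have h5 : k ^ n ≤ (minpoly A t).natDegree * (minpoly B y).natDegree :=
    Nat.le_of_dvd h4 (by rw [h1, ← h2, h3]; exact dvd_mul_right _ _)
  exact absurd (h5.trans (Nat.mul_le_mul_left _ hyBD)) (by omega)

/-- `F` is algebraically closed in `F(t)`, so an element algebraic over `F` does not drop in degree
over `F(t)`. -/
theorem RatFunc.natDegree_minpoly_le {x : K} (hx : IsAlgebraic F x) :
    (minpoly F x).natDegree ≤ (minpoly (RatFunc F) x).natDegree := by
  have hx' : IsIntegral F x := hx.isIntegral
  have hxR : IsIntegral (RatFunc F) x := hx'.tower_top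
  -- The coefficients of the minimal polynomial over `F(t)` are algebraic over `F`, so constant.
  obtain ⟨q, hq⟩ := (Polynomial.mem_lifts _).1
    (integralClosure.mem_lifts_of_monic_of_dvd_map (RatFunc F)
      (minpoly.monic hx') (minpoly.monic hxR) (minpoly.dvd_map_of_isScalarTower F (RatFunc F) x))
  have hcoeff : minpoly (RatFunc F) x ∈ Polynomial.lifts (algebraMap F (RatFunc F)) := by
    rw [Polynomial.lifts_iff_coeff_lifts]
    intro n
    rw [← hq, Polynomial.coeff_map]
    by_contra hc
    refine RatFunc.transcendental_of_ne_C _ (fun ⟨c, hc'⟩ ↦ hc ⟨c, ?_⟩)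
      (IsIntegral.isAlgebraic (q.coeff n).2)
    exact hc'.symm
  obtain ⟨p, hp, hpdeg, hpm⟩ :=
    Polynomial.lifts_and_natDegree_eq_and_monic hcoeff (minpoly.monic hxR)
  rw [← hpdeg]
  refine Polynomial.natDegree_le_natDegree (minpoly.min F x hpm ?_)
  have := minpoly.aeval (RatFunc F) x
  rwa [← hp, Polynomial.aeval_map_algebraMap] at this

end

/-- An element algebraic over a finite field `F`, of degree `i ≤ D`, satisfies
`x ^ (|F| ^ i - 1) = 1`. -/
lemma FiniteField.pow_prod_eq_one {F K : Type*} [Field F] [Finite F] [Field K] [Algebra F K]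
    {D : ℕ} {x : K} (hx : IsAlgebraic F x) (hx0 : x ≠ 0)
    (hD : (minpoly F x).natDegree ≤ D) :
    x ^ (∏ i ∈ Finset.Icc 1 D, (Nat.card F ^ i - 1)) = 1 := by
  have hx' : IsIntegral F x := hx.isIntegral
  have : FiniteDimensional F F⟮x⟯ := IntermediateField.adjoin.finiteDimensional hx'
  have : Finite F⟮x⟯ := Module.finite_of_finite F
  have hcard : Nat.card F⟮x⟯ = Nat.card F ^ (minpoly F x).natDegree := by
    rw [Module.natCard_eq_pow_finrank (K := F), IntermediateField.adjoin.finrank hx']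
  have h1 : x ^ (Nat.card F ^ (minpoly F x).natDegree - 1) = 1 := by
    rw [← hcard]
    let g : F⟮x⟯ := IntermediateField.AdjoinSimple.gen F x
    have hg : g ≠ 0 := fun h0 ↦ hx0 (congrArg (Subtype.val : F⟮x⟯ → K) h0)
    have := Fintype.ofFinite F⟮x⟯
    have h2 := FiniteField.pow_card_sub_one_eq_one g hg
    rw [← Nat.card_eq_fintype_card] at h2
    exact congrArg (Subtype.val : F⟮x⟯ → K) h2
  obtain ⟨c, hc⟩ := Finset.dvd_prod_of_mem (fun i ↦ Nat.card F ^ i - 1)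
    (Finset.mem_Icc.2 ⟨minpoly.natDegree_pos hx', hD⟩)
  rw [hc, pow_mul, h1, one_pow]

/-! ### Infinitely divisible elements of bounded degree: global fields -/

/-- The point is that the exponent `N` depends on `E` and `d` only. -/
theorem IsGlobalField.exists_pow_eq_one {E : Type*} [Field E] (hE : IsGlobalField E) {k : ℕ}
    (hk : 1 < k) (d : ℕ) : ∃ N : ℕ, 0 < N ∧ ∀ x : AlgebraicClosure E, x ≠ 0 →
      (∀ n : ℕ, ∃ y : AlgebraicClosure E, y ^ k ^ n = x ∧ (minpoly E y).natDegree ≤ d) →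
      x ^ N = 1 := by
  have hint (y : AlgebraicClosure E) : IsIntegral E y := Algebra.IsIntegral.isIntegral y
  rcases hE with hE | ⟨p, hp, hAlg, hfun⟩
  · refine ⟨((d * Module.finrank ℚ E + 1).factorial) ^ (d * Module.finrank ℚ E + 1),
      by positivity, fun x hx h ↦ NumberField.pow_eq_one_of_forall_exists_root hk hx fun n ↦ ?_⟩
    obtain ⟨y, hyx, hy⟩ := h n
    exact ⟨y, hyx, hint y, hy⟩
  · let : Algebra (ZMod p) E :=
      ((algebraMap (RatFunc (ZMod p)) E).comp (algebraMap (ZMod p) (RatFunc (ZMod p)))).toAlgebra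
    have : IsScalarTower (ZMod p) (RatFunc (ZMod p)) E := IsScalarTower.of_algebraMap_eq fun _ ↦ rfl
    have : IsScalarTower (ZMod p) (RatFunc (ZMod p)) (AlgebraicClosure E) :=
        .of_algebraMap_eq' <| by
          rw [IsScalarTower.algebraMap_eq (ZMod p) E (AlgebraicClosure E),
            IsScalarTower.algebraMap_eq (RatFunc (ZMod p)) E (AlgebraicClosure E), RingHom.comp_assoc,
            ← IsScalarTower.algebraMap_eq (ZMod p) (RatFunc (ZMod p)) E]
    have : Algebra.IsAlgebraic (RatFunc (ZMod p)) (AlgebraicClosure E) :=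
      Algebra.IsAlgebraic.trans _ E _
    let D := d * Module.finrank (RatFunc (ZMod p)) E
    refine ⟨∏ i ∈ Finset.Icc 1 D, (Nat.card (ZMod p) ^ i - 1), ?_, fun x hx h ↦ ?_⟩
    · refine Finset.prod_pos fun i hi ↦ Nat.sub_pos_of_lt ?_
      rw [Nat.card_zmod]
      exact Nat.one_lt_pow (by have := (Finset.mem_Icc.1 hi).1; omega) hp.out.one_lt
    · have h' (n : ℕ) : ∃ y : AlgebraicClosure E,
          y ^ k ^ n = x ∧ (minpoly (RatFunc (ZMod p)) y).natDegree ≤ D := by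
        obtain ⟨y, hyx, hy⟩ := h n
        exact ⟨y, hyx, (minpoly.natDegree_le_natDegree_mul_finrank (hint y)).trans
          (Nat.mul_le_mul_right _ hy)⟩
      have halg : IsAlgebraic (ZMod p) x := RatFunc.isAlgebraic_of_forall_exists_root hk h'
      obtain ⟨y, hyx, hy⟩ := h' 0
      obtain rfl : y = x := by simpa using hyx
      exact FiniteField.pow_prod_eq_one halg hx ((RatFunc.natDegree_minpoly_le halg).trans hy)

/-! ### Linear groups with a surjective power map -/

lemma natDegree_minpoly_le_of_mem_spectrum {E K n : Type*} [Field E] [Field K] [Algebra E K]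
    [Fintype n] [DecidableEq n] {M : Matrix n n E} {y : K}
    (hy : y ∈ spectrum K (M.map (algebraMap E K))) :
    (minpoly E y).natDegree ≤ Fintype.card n := by
  rw [Matrix.mem_spectrum_iff_isRoot_charpoly, Matrix.charpoly_map,
    Polynomial.IsRoot.def, Polynomial.eval_map_algebraMap] at hy
  rw [← M.charpoly_natDegree_eq_dim]
  exact Polynomial.natDegree_le_natDegree (minpoly.min E y M.charpoly_monic hy)

lemma PowerMapSurjective.exists_pow_pow_eq {G : Type*} [Group G] {k : ℕ}
    (h : PowerMapSurjective G k) (n : ℕ) (x : G) : ∃ y : G, y ^ k ^ n = x := by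
  induction n with
  | zero => exact ⟨x, by simp⟩
  | succ n ih =>
    obtain ⟨y, rfl⟩ := ih
    obtain ⟨z, rfl⟩ := h y
    exact ⟨z, by rw [pow_succ', pow_mul]⟩

lemma PowerMapSurjective.of_dvd {G : Type*} [Group G] {k l : ℕ}
    (h : PowerMapSurjective G k) (hl : l ∣ k) : PowerMapSurjective G l := by
  obtain ⟨c, rfl⟩ := hl
  intro x
  obtain ⟨y, rfl⟩ := h x
  exact ⟨y ^ c, by simp only [← pow_mul, mul_comm c l]⟩

section

variable {E : Type*} [Field E] {d : ℕ} {H : Subgroup (Matrix.GeneralLinearGroup (Fin d) E)}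

/-- The eigenvalues of the elements of `H` have `k ^ n`-th roots of degree at most `d` for all `n`,
namely eigenvalues of `k ^ n`-th roots in `H`. So they are roots of unity of bounded order. -/
theorem exists_normal_finiteIndex_of_forall_pow_eq_one (K : Type*) [Field K] [IsAlgClosed K]
    [Algebra E K] {k N : ℕ} (hk : 1 < k) (hN : 0 < N)
    (hroot : ∀ x : K, x ≠ 0 →
      (∀ n : ℕ, ∃ y : K, y ^ k ^ n = x ∧ (minpoly E y).natDegree ≤ d) → x ^ N = 1)
    (hsurj : PowerMapSurjective H k) :
    ∃ U : Subgroup H, U.Normal ∧ U.FiniteIndex ∧ ∃ m, ∀ l : List H, (∀ g ∈ l, g ∈ U) →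
      l.length = m → (l.map fun g ↦ (g.1.1 : Matrix (Fin d) (Fin d) E) - 1).prod = 0 := by
  let ι : Matrix (Fin d) (Fin d) E →+* Matrix (Fin d) (Fin d) K := (algebraMap E K).mapMatrix
  have hι : Function.Injective ι := Matrix.map_injective (algebraMap E K).injective
  let ρ : H →* Matrix (Fin d) (Fin d) K :=
    (ι : Matrix (Fin d) (Fin d) E →* _).comp ((Units.coeHom _).comp H.subtype)
  have hρ (h : H) : IsNilpotent (ρ h ^ N - 1) := by
    refine isNilpotent_pow_sub_one_of_roots_charpoly fun x hx ↦ ?_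
    have hxs : x ∈ spectrum K (ρ h) :=
      Matrix.mem_spectrum_of_isRoot_charpoly (Polynomial.isRoot_of_mem_roots hx)
    have hu : IsUnit (ρ h) := (Group.isUnit h).map ρ
    refine hroot x (fun h0 ↦ (spectrum.zero_notMem_iff K).2 hu (h0 ▸ hxs)) fun n ↦ ?_
    obtain ⟨g, hg⟩ := hsurj.exists_pow_pow_eq n h
    rw [← hg, map_pow, spectrum.map_pow_of_pos _ (pow_pos (by omega) n)] at hxs
    obtain ⟨y, hy, hyx⟩ := hxs
    refine ⟨y, hyx, ?_⟩
    exact (natDegree_minpoly_le_of_mem_spectrum hy).trans_eq (Fintype.card_fin d)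
  obtain ⟨U, hU, hU', m, hm⟩ := exists_normal_finiteIndex_nilpotent (K := K) ρ hN hρ
  refine ⟨U, hU, hU', m, fun l hl hlm ↦ hι ?_⟩
  rw [map_list_prod, List.map_map, map_zero, ← hm l hl hlm]
  congr 2
  ext g : 1
  simp [ρ]

theorem exists_normal_finiteIndex_of_powerMapSurjective (hE : IsGlobalField E) {k : ℕ} (hk : 1 < k)
    (hsurj : PowerMapSurjective H k) :
    ∃ U : Subgroup H, U.Normal ∧ U.FiniteIndex ∧ ∃ m, ∀ l : List H, (∀ g ∈ l, g ∈ U) →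
      l.length = m → (l.map fun g ↦ (g.1.1 : Matrix (Fin d) (Fin d) E) - 1).prod = 0 := by
  obtain ⟨N, hN, hroot⟩ := hE.exists_pow_eq_one hk d
  exact exists_normal_finiteIndex_of_forall_pow_eq_one (AlgebraicClosure E) hk hN hroot hsurj

lemma sub_one_pow_eq_zero_of_forall_list {U : Subgroup H} {m : ℕ}
    (hm : ∀ l : List H, (∀ g ∈ l, g ∈ U) → l.length = m →
      (l.map fun g ↦ (g.1.1 : Matrix (Fin d) (Fin d) E) - 1).prod = 0) {g : H} (hg : g ∈ U) :
    ((g.1.1 : Matrix (Fin d) (Fin d) E) - 1) ^ m = 0 := by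
  simpa using hm (List.replicate m g) (fun x hx ↦ List.eq_of_mem_replicate hx ▸ hg) (by simp)

/-- In characteristic `p`, a finitely generated subgroup meets the unipotent subgroup `U` in a
finitely generated group, which is finite. -/
theorem isLocallyFiniteGroup_of_powerMapSurjective (hE : IsGlobalField E) {k : ℕ} (hk : 1 < k)
    (hsurj : PowerMapSurjective H k) {p : ℕ} (hp : 0 < p) [CharP E p] : IsLocallyFiniteGroup H := by
  obtain ⟨U, hU, hU', m, hm⟩ := exists_normal_finiteIndex_of_powerMapSurjective hE hk hsurj
  intro N hN
  have : Group.FG N := (Group.fg_iff_subgroup_fg N).2 hN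
  have : NeZero p := ⟨hp.ne'⟩
  let : Algebra (ZMod p) E := ZMod.algebra E p
  let V : Subgroup N := U.subgroupOf N
  let ρ : V →* Matrix (Fin d) (Fin d) E :=
    (Units.coeHom _).comp (H.subtype.comp (N.subtype.comp V.subtype))
  have hρ : Function.Injective ρ := Units.val_injective.comp
    (Subtype.val_injective.comp (Subtype.val_injective.comp Subtype.val_injective))
  have : Finite V := by
    refine finite_of_fg_of_forall_list_prod_eq_zero (p := p) (m := m) ρ hρ fun l hl ↦ ?_
    have := hm (l.map fun g ↦ g.1.1) (fun g hg ↦ by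
      obtain ⟨v, -, rfl⟩ := List.mem_map.1 hg
      exact Subgroup.mem_subgroupOf.1 v.2) (by simpa using hl)
    rw [List.map_map] at this
    exact this
  exact Finite.of_equiv _ (Subgroup.groupEquivQuotientProdSubgroup (s := V)).symm

/-- If `P_p` is surjective, then `H`, being of finite exponent, has no `p`-torsion; so the
unipotent subgroup `U` is trivial. -/
theorem finite_of_powerMapSurjective_of_dvd (hE : IsGlobalField E) {k : ℕ} (hk : 1 < k)
    (hsurj : PowerMapSurjective H k) {p : ℕ} (hp : 0 < p) [CharP E p] (hpk : p ∣ k) :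
    Finite H := by
  have hpp : p.Prime := (CharP.char_is_prime_or_zero E p).resolve_right hp.ne'
  have : Fact p.Prime := ⟨hpp⟩
  obtain ⟨U, hU, hU', m, hm⟩ := exists_normal_finiteIndex_of_powerMapSurjective hE hk hsurj
  have hUpow (u : H) (hu : u ∈ U) : u ^ p ^ m = 1 := by
    apply Subtype.ext
    apply Units.ext
    -- For `d = 0` the matrix ring is trivial and does not have characteristic `p`.
    rcases isEmpty_or_nonempty (Fin d) with hd | hd
    · exact Subsingleton.elim _ _
    · have h1 : ((u.1.1 : Matrix (Fin d) (Fin d) E) - 1) ^ p ^ m = 0 :=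
        pow_eq_zero_of_le (Nat.lt_pow_self hpp.one_lt).le (sub_one_pow_eq_zero_of_forall_list hm hu)
      rw [sub_pow_char_pow_of_commute _ _ (Commute.one_right _), one_pow, sub_eq_zero] at h1
      simpa using h1
  have hindex : U.index ≠ 0 := Subgroup.FiniteIndex.index_ne_zero
  have hexp (h : H) : h ^ (U.index * p ^ m) = 1 := by
    rw [pow_mul]
    exact hUpow _ (U.pow_index_mem h)
  -- `H` has exponent dividing `p ^ c * r`, and every element of `H` is a `p ^ c`-th power.
  obtain ⟨c, r, hr, hcr⟩ := Nat.exists_eq_pow_mul_and_not_dvd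
    (mul_ne_zero hindex (pow_pos hp m).ne') p hpp.ne_one
  have hUbot : U = ⊥ := by
    rw [eq_bot_iff]
    intro u hu
    obtain ⟨y, rfl⟩ := (hsurj.of_dvd hpk).exists_pow_pow_eq c u
    have h1 : (y ^ p ^ c) ^ r = 1 := by rw [← pow_mul, ← hcr, hexp]
    have hcop : (p ^ m).Coprime r :=
      Nat.Coprime.pow_left _ ((Nat.Prime.coprime_iff_not_dvd hpp).2 hr)
    have := Nat.dvd_gcd (orderOf_dvd_of_pow_eq_one (hUpow _ hu)) (orderOf_dvd_of_pow_eq_one h1)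
    rw [hcop.gcd_eq_one, Nat.dvd_one, orderOf_eq_one_iff] at this
    exact Subgroup.mem_bot.2 this
  subst hUbot
  rw [Subgroup.index_bot] at hindex
  exact Nat.finite_of_card_ne_zero hindex

end

theorem corollary3p7 {E : Type*} [Field E] (hE : IsGlobalField E) (d : ℕ)
    (H : Subgroup (Matrix.GeneralLinearGroup (Fin d) E))
    (k : ℕ) (hk : 1 < k) (hsurj : PowerMapSurjective H k) :
    (CharZero E →
      ∃ U : Subgroup H, U.Normal ∧ U.FiniteIndex ∧ IsUnipotentGroup (U.map H.subtype)) ∧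
    (∀ p : ℕ, 0 < p → CharP E p → IsLocallyFiniteGroup H) ∧
    (∀ p : ℕ, 0 < p → CharP E p → p ∣ k → Finite H) ∧
    ((∀ n : ℕ, 1 ≤ n → PowerMapSurjective H n) →
      (CharZero E → IsUnipotentGroup H) ∧
      (∀ p : ℕ, 0 < p → CharP E p → H = ⊥)) := by
  refine ⟨fun _ ↦ ?_, fun p hp _ ↦ isLocallyFiniteGroup_of_powerMapSurjective hE hk hsurj hp,
    fun p hp _ hpk ↦ finite_of_powerMapSurjective_of_dvd hE hk hsurj hp hpk,
    fun hall ↦ ⟨fun _ g hg ↦ ?_, fun p hp _ ↦ ?_⟩⟩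
  · obtain ⟨U, hU, hU', m, hm⟩ := exists_normal_finiteIndex_of_powerMapSurjective hE hk hsurj
    refine ⟨U, hU, hU', ?_⟩
    rintro _ ⟨u, hu, rfl⟩
    exact ⟨m, sub_one_pow_eq_zero_of_forall_list hm hu⟩
  · obtain ⟨U, hU, hU', m, hm⟩ := exists_normal_finiteIndex_of_powerMapSurjective hE hk hsurj
    obtain ⟨y, hy⟩ := hall U.index (Nat.one_le_iff_ne_zero.2 Subgroup.FiniteIndex.index_ne_zero)
      ⟨g, hg⟩
    have hgU : (⟨g, hg⟩ : H) ∈ U := hy ▸ U.pow_index_mem y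
    exact ⟨m, sub_one_pow_eq_zero_of_forall_list hm hgU⟩
  · have hpp : p.Prime := (CharP.char_is_prime_or_zero E p).resolve_right hp.ne'
    have : Finite H := finite_of_powerMapSurjective_of_dvd hE hpp.one_lt (hall p hp) hp dvd_rfl
    rw [eq_bot_iff]
    intro g hg
    obtain ⟨y, hy⟩ := hall (Nat.card H) Nat.card_pos ⟨g, hg⟩
    have h1 : (⟨g, hg⟩ : H) = 1 := by rw [← hy]; exact pow_card_eq_one'
    exact Subgroup.mem_bot.2 (congrArg Subtype.val h1)
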